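/- Let $k$ be a field and let $R$ be a local noetherian $k$-algebra with maximal ideal $P$. Assume that the $P$-adic completion of $R$ is isomorphic, as a $k$-algebra, to the formal power series ring $k[[x_1,\dots,x_r]]$ in $r>0$ variables. Let $n$ be a positive integer. For a noetherian $k$-scheme $T$ let $\mathcal{H}ilb^nR(T)$ be the set of closed subschemes $Z\subseteq T\times_k\operatorname{Spec}(R)$ such that the projection $Z\to T$ is flat, such that for every point $y\in T$ the global sections of the fiber $Z_y=Z\times_T\operatorname{Spec}(\kappa(y))$ form a $\kappa(y)$-vector space of dimension $n$, and such that $Z_{\mathrm{red}}\subseteq T\times_k\operatorname{Spec}(R/P)$. With pull-back of closed subschemes, this is a contravariant functor from the category of noetherian $k$-schemes to sets. Then the functor $\mathcal{H}ilb^nR$ is not representable in the category of noetherian $k$-schemes. -/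

import Mathlib

open CategoryTheory CategoryTheory.Limits AlgebraicGeometry Opposite

universe u

noncomputable section

namespace LocalHilb

/-- The dimension of the global sections of the scheme-theoretic fibre of `f : Z ⟶ T` at `y`,
as a vector space over the residue field `κ(y)`. It is a cardinal, so that
`fiberRank f y = n` for a natural number `n` includes finite-dimensionality. -/
def fiberRank {Z T : Scheme.{u}} (f : Z ⟶ T) (y : T) : Cardinal.{u} :=
  letI : Module (T.residueField y) Γ(f.fiber y, ⊤) :=
    RingHom.toModule
      ((Scheme.ΓSpecIso (T.residueField y)).inv ≫ (f.fiberToSpecResidueField y).appTop).hom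
  Module.rank (T.residueField y) Γ(f.fiber y, ⊤)

/-- For a base change `f'` of an affine morphism `f` along `g`, the dimension of the global
sections of a fibre does not change. -/
theorem fiberRank_of_isPullback {W Z U T : Scheme.{u}} {g' : W ⟶ Z} {f' : W ⟶ U}
    {f : Z ⟶ T} {g : U ⟶ T} (h : IsPullback g' f' f g) [IsAffineHom f] [IsAffineHom f'] (y : U) :
    fiberRank f' y = fiberRank f (g y) := by
  have hp := isPullback_fiberToSpecResidueField_of_isPullback h y
  have hpo := isPushout_appTop_of_isPullback hp
  have e : IsPushout
      ((Scheme.ΓSpecIso (T.residueField (g y))).inv ≫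
        (f.fiberToSpecResidueField (g y)).appTop)
      (g.residueFieldMap y)
      (pullback.map _ _ _ _ g' (Spec.map (g.residueFieldMap y)) g h.w.symm
        (by simp)).appTop
      ((Scheme.ΓSpecIso (U.residueField y)).inv ≫ (f'.fiberToSpecResidueField y).appTop) := by
    refine hpo.of_iso (Scheme.ΓSpecIso _) (Iso.refl _) (Scheme.ΓSpecIso _) (Iso.refl _)
      ?_ ?_ ?_ ?_
    · exact (Category.comp_id _).trans (Iso.hom_inv_id_assoc _ _).symm
    · exact Scheme.ΓSpecIso_naturality (g.residueFieldMap y)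
    · exact (Category.comp_id _).trans (Category.id_comp _).symm
    · exact (Category.comp_id _).trans (Iso.hom_inv_id_assoc _ _).symm
  let : Algebra (T.residueField (g y)) Γ(f.fiber (g y), ⊤) := RingHom.toAlgebra
    ((Scheme.ΓSpecIso (T.residueField (g y))).inv ≫
      (f.fiberToSpecResidueField (g y)).appTop).hom
  let : Algebra (U.residueField y) Γ(f'.fiber y, ⊤) := RingHom.toAlgebra
    ((Scheme.ΓSpecIso (U.residueField y)).inv ≫ (f'.fiberToSpecResidueField y).appTop).hom
  let : Algebra (T.residueField (g y)) (U.residueField y) :=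
    (g.residueFieldMap y).hom.toAlgebra
  let : Algebra Γ(f.fiber (g y), ⊤) Γ(f'.fiber y, ⊤) := RingHom.toAlgebra
    (pullback.map _ _ _ _ g' (Spec.map (g.residueFieldMap y)) g h.w.symm
        (by simp)).appTop.hom
  let : Algebra (T.residueField (g y)) Γ(f'.fiber y, ⊤) := RingHom.toAlgebra
    ((algebraMap (U.residueField y) Γ(f'.fiber y, ⊤)).comp
      (algebraMap (T.residueField (g y)) (U.residueField y)))
  have : IsScalarTower (T.residueField (g y)) (U.residueField y) Γ(f'.fiber y, ⊤) :=
    .of_algebraMap_eq' rfl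
  have : IsScalarTower (T.residueField (g y)) Γ(f.fiber (g y), ⊤) Γ(f'.fiber y, ⊤) :=
    .of_algebraMap_eq' (congrArg CommRingCat.Hom.hom e.w.symm)
  have hA : Algebra.IsPushout (T.residueField (g y)) (U.residueField y)
      Γ(f.fiber (g y), ⊤) Γ(f'.fiber y, ⊤) := CommRingCat.isPushout_iff_isPushout.mp e.flip
  have := (Algebra.IsPushout.equiv (T.residueField (g y)) (U.residueField y)
      Γ(f.fiber (g y), ⊤) Γ(f'.fiber y, ⊤)).toLinearEquiv.rank_eq
  refine this.symm.trans ?_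
  rw [Module.rank_baseChange, Cardinal.lift_id]
  rfl

variable (k : Type u) [Field k] (R : Type u) [CommRing R] [Algebra k R]

/-- The structure morphism `Spec R ⟶ Spec k` of a `k`-algebra `R`. -/
def specHom : Spec (CommRingCat.of R) ⟶ Spec (CommRingCat.of k) :=
  Spec.map (CommRingCat.ofHom (algebraMap k R))

/-- The product `T ×_k Spec R`, for a `k`-scheme `T`. -/
abbrev prodSpec (T : Over (Spec (CommRingCat.of k))) : Scheme.{u} :=
  pullback T.hom (specHom k R)

/-- The morphism `f × id : T' ×_k Spec R ⟶ T ×_k Spec R`. -/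
def prodSpecMap {T' T : Over (Spec (CommRingCat.of k))} (f : T' ⟶ T) :
    prodSpec k R T' ⟶ prodSpec k R T :=
  pullback.lift (pullback.fst _ _ ≫ f.left) (pullback.snd _ _)
    (by rw [Category.assoc, Over.w, pullback.condition])

theorem prodSpecMap_fst {T' T : Over (Spec (CommRingCat.of k))} (f : T' ⟶ T) :
    prodSpecMap k R f ≫ pullback.fst _ _ = pullback.fst _ _ ≫ f.left :=
  pullback.lift_fst _ _ _

theorem prodSpecMap_snd {T' T : Over (Spec (CommRingCat.of k))} (f : T' ⟶ T) :
    prodSpecMap k R f ≫ pullback.snd _ _ = pullback.snd _ _ :=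
  pullback.lift_snd _ _ _

/-- The projection to `T` of the closed subscheme of `T ×_k Spec R` with ideal sheaf `I`. -/
def proj (T : Over (Spec (CommRingCat.of k))) (I : (prodSpec k R T).IdealSheafData) :
    I.subscheme ⟶ T.left :=
  I.subschemeι ≫ pullback.fst _ _

/-- The ideal sheaf of the closed subscheme `T ×_k Spec (R / P)` of `T ×_k Spec R`, where `P` is
the maximal ideal of the local ring `R`: the pullback of the ideal sheaf of
`Spec (R / P) ⊆ Spec R`. -/
def closedPointIdeal [IsLocalRing R] (T : Over (Spec (CommRingCat.of k))) :
    (prodSpec k R T).IdealSheafData :=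
  (Spec.map (CommRingCat.ofHom (IsLocalRing.residue R))).ker.comap
    (pullback.snd T.hom (specHom k R))

/-- The condition on a closed subscheme `Z ⊆ T ×_k Spec R` with ideal sheaf `I` to be a
`T`-valued point. The ideal sheaf of `Z_red` is the radical of `I`, and inclusions of closed
subschemes are reverse inclusions of ideal sheaves. -/
structure IsPoint [IsLocalRing R] (n : ℕ) (T : Over (Spec (CommRingCat.of k)))
    (I : (prodSpec k R T).IdealSheafData) : Prop where
  /-- `Z ⟶ T` is flat. -/
  flat : Flat (proj k R T I)
  /-- The global sections of each fibre `Z_y` have dimension `n` over `κ(y)`. -/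
  rank : ∀ y : T.left, fiberRank (proj k R T I) y = n
  /-- `Z_red ⊆ T ×_k Spec (R / P)`. -/
  supp : closedPointIdeal k R T ≤ I.radical

variable {k R}

theorem radical_le_iff {X : Scheme.{u}} (I J : X.IdealSheafData) :
    I ≤ J.radical ↔ J.support ≤ I.support := by
  rw [← Scheme.IdealSheafData.vanishingIdeal_support,
    ← Scheme.IdealSheafData.le_support_iff_le_vanishingIdeal]

@[simp]
theorem prodSpecMap_id (T : Over (Spec (CommRingCat.of k))) :
    prodSpecMap k R (𝟙 T) = 𝟙 _ := by
  apply pullback.hom_ext <;> simp [prodSpecMap]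

theorem prodSpecMap_comp {T₁ T₂ T₃ : Over (Spec (CommRingCat.of k))} (f : T₁ ⟶ T₂)
    (g : T₂ ⟶ T₃) :
    prodSpecMap k R (f ≫ g) = prodSpecMap k R f ≫ prodSpecMap k R g := by
  apply pullback.hom_ext
  · rw [prodSpecMap_fst, Category.assoc, prodSpecMap_fst, ← Category.assoc, prodSpecMap_fst,
      Over.comp_left, Category.assoc]
  · rw [prodSpecMap_snd, Category.assoc, prodSpecMap_snd, prodSpecMap_snd]

theorem closedPointIdeal_comap [IsLocalRing R] {T' T : Over (Spec (CommRingCat.of k))}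
    (f : T' ⟶ T) :
    (closedPointIdeal k R T).comap (prodSpecMap k R f) = closedPointIdeal k R T' := by
  rw [closedPointIdeal, ← Scheme.IdealSheafData.comap_comp]
  rw [prodSpecMap_snd, closedPointIdeal]

theorem isAffineHom_fst {X Y S : Scheme.{u}} (f : X ⟶ S) (g : Y ⟶ S) [IsAffineHom g] :
    IsAffineHom (pullback.fst f g) :=
  isAffineHom_isStableUnderBaseChange.of_isPullback (IsPullback.of_hasPullback f g).flip ‹_›

instance isAffineHom_proj (T : Over (Spec (CommRingCat.of k)))
    (I : (prodSpec k R T).IdealSheafData) :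
    IsAffineHom (proj k R T I) := by
  have : IsAffineHom (specHom k R) := by unfold specHom; infer_instance
  have h : IsAffineHom (pullback.fst T.hom (specHom k R)) :=
    isAffineHom_fst T.hom (specHom k R)
  unfold proj
  infer_instance

theorem isPullback_proj {T' T : Over (Spec (CommRingCat.of k))} (f : T' ⟶ T)
    (I : (prodSpec k R T).IdealSheafData) :
    IsPullback ((I.comapIso (prodSpecMap k R f)).hom ≫ pullback.snd _ _)
      (proj k R T' (I.comap (prodSpecMap k R f))) (proj k R T I) f.left := by
  have h1 : IsPullback ((I.comapIso (prodSpecMap k R f)).hom ≫ pullback.snd _ _)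
      (I.comap (prodSpecMap k R f)).subschemeι I.subschemeι (prodSpecMap k R f) := by
    refine (IsPullback.of_hasPullback (prodSpecMap k R f) I.subschemeι).flip.of_iso
      (I.comapIso (prodSpecMap k R f)).symm (Iso.refl _) (Iso.refl _) (Iso.refl _) ?_ ?_ ?_ ?_
    · exact (Category.comp_id _).trans (Iso.inv_hom_id_assoc _ _).symm
    · exact (Category.comp_id _).trans (Scheme.IdealSheafData.comapIso_inv_subschemeι _ _).symm
    · exact (Category.comp_id _).trans (Category.id_comp _).symm
    · exact (Category.comp_id _).trans (Category.id_comp _).symm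
  have h2 : IsPullback (prodSpecMap k R f) (pullback.fst T'.hom (specHom k R))
      (pullback.fst T.hom (specHom k R)) f.left := by
    refine IsPullback.of_right (h₁₂ := pullback.snd _ _) (v₁₃ := specHom k R) (h₂₂ := T.hom)
      ?_ ?_ (IsPullback.of_hasPullback T.hom (specHom k R)).flip
    · rw [prodSpecMap_snd, Over.w]
      exact (IsPullback.of_hasPullback T'.hom (specHom k R)).flip
    · exact prodSpecMap_fst k R f
  exact h1.paste_vert h2

/-- Points pull back to points. -/
theorem IsPoint.comap [IsLocalRing R] {n : ℕ} {T' T : Over (Spec (CommRingCat.of k))}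
    (f : T' ⟶ T) {I : (prodSpec k R T).IdealSheafData} (h : IsPoint k R n T I) :
    IsPoint k R n T' (I.comap (prodSpecMap k R f)) where
  flat := MorphismProperty.of_isPullback (isPullback_proj f I) h.flat
  rank y := by rw [fiberRank_of_isPullback (isPullback_proj f I), h.rank]
  supp := by
    have := h.supp
    rw [radical_le_iff] at this ⊢
    rw [← closedPointIdeal_comap f, Scheme.IdealSheafData.support_comap,
      Scheme.IdealSheafData.support_comap]
    exact fun x hx ↦ this hx

variable (k R)

/-- The category of noetherian `k`-schemes (and all morphisms of `k`-schemes). -/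
abbrev NoethSch : Type (u + 1) :=
  ObjectProperty.FullSubcategory
    fun T : Over (Spec (CommRingCat.of k)) ↦ AlgebraicGeometry.IsNoetherian T.left

/-- The contravariant functor `Hilb^n R` from noetherian `k`-schemes to sets: it sends `T` to the
set of closed subschemes `Z ⊆ T ×_k Spec R` (given by their ideal sheaves), flat over `T`, whose
fibres have global sections of dimension `n`, with `Z_red ⊆ T ×_k Spec (R / P)`. Morphisms act by
pullback of closed subschemes. -/
def hilb [IsLocalRing R] (n : ℕ) : (NoethSch k)ᵒᵖ ⥤ Type u where
  obj T := {I : (prodSpec k R T.unop.obj).IdealSheafData // IsPoint k R n T.unop.obj I}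
  map f := ↾fun I ↦ ⟨I.1.comap (prodSpecMap k R f.unop.hom), I.2.comap f.unop.hom⟩
  map_id T := by
    ext I : 3
    apply Subtype.ext
    exact (congrArg I.1.comap (prodSpecMap_id _)).trans (Scheme.IdealSheafData.comap_id _)
  map_comp f g := by
    ext I : 3
    apply Subtype.ext
    exact (congrArg I.1.comap (prodSpecMap_comp _ _)).trans
      (Scheme.IdealSheafData.comap_comp _ _ _)

end LocalHilb

end

/-! Each family is infinitesimally thickened only to a finite order, but no bound on this order
holds for all families, while a noetherian universal family would impose one. Let `H` represent the
functor, with universal family `Z`. Since `H` is quasi-compact and `Z` is affine over it, `Z` is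
quasi-compact. The support condition makes each `p` in `P` vanish at all points of `Z`, so `p ^ N =
0` on `Z` for one `N`, and then on every pullback of `Z`, that is, on every family
(`exists_pow_eq_zero_of_isRepresentable`). Against this stands the family `x ^ (n - 1) * (x - t) =
0` over `k[t] / (t ^ (M + 1))`: there `x` is nilpotent, but `x ^ M ≠ 0` (`exists_family`). To embed
it in the product with `Spec R`, the completion provides `R → k[[X]]` with `X` in the closure of the
image, and evaluation at the nilpotent `x` follows. Some `p` in `P` then maps to a unit times `x`,
and `M = N` is a contradiction. -/

namespace LocalHilb

open TensorProduct

/-! ### Maps from `R` through power series in one variable -/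

/-- A homomorphism of `k`-algebras from a local ring to power series over `k` is local. -/
theorem X_dvd_of_mem_maximalIdeal {k R : Type*} [Field k] [CommRing R] [Algebra k R]
    [IsLocalRing R] (φ : R →ₐ[k] PowerSeries k) {p : R} (hp : p ∈ IsLocalRing.maximalIdeal R) :
    PowerSeries.X ∣ φ p := by
  rw [PowerSeries.X_dvd_iff]
  by_contra hc
  set c := PowerSeries.constantCoeff (φ p) with hcdef
  -- A nonzero constant minus a nonunit is a unit, yet its image has constant coefficient `c - c =
  -- 0`.
  have hu : IsUnit (algebraMap k R c - p) := by
    by_contra h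
    have h1 : algebraMap k R c ∈ IsLocalRing.maximalIdeal R := by
      have := Ideal.add_mem _ ((IsLocalRing.mem_maximalIdeal _).mpr h) hp
      simpa using this
    exact (IsLocalRing.mem_maximalIdeal _).mp h1 ((IsUnit.mk0 c hc).map (algebraMap k R))
  have h2 := (hu.map φ).map (PowerSeries.constantCoeff (R := k))
  simp [← hcdef] at h2

/-- A local ring whose completion is a power series ring maps to power series in one variable, with
the variable in the closure of the image. -/
theorem exists_algHom_powerSeries {k R : Type*} [Field k] [CommRing R] [Algebra k R]
    [IsLocalRing R] [IsNoetherianRing R] {r : ℕ} (hr : 0 < r)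
    (e : AdicCompletion (IsLocalRing.maximalIdeal R) R ≃ₐ[k] MvPowerSeries (Fin r) k) :
    ∃ φ : R →ₐ[k] PowerSeries k, ∀ m : ℕ, ∃ p : R, PowerSeries.X ^ m ∣ φ p - PowerSeries.X := by
  -- Restrict to a coordinate axis: the first variable goes to `X`, all others to `0`.
  have ha : MvPowerSeries.HasSubst
      (fun i : Fin r ↦ if i = ⟨0, hr⟩ then (PowerSeries.X : PowerSeries k) else 0) := by
    refine MvPowerSeries.hasSubst_of_constantCoeff_zero fun i ↦ ?_
    split_ifs
    · exact PowerSeries.constantCoeff_X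
    · exact map_zero _
  let π : AdicCompletion (IsLocalRing.maximalIdeal R) R →ₐ[k] PowerSeries k :=
    (MvPowerSeries.substAlgHom (R := k) ha).comp e.toAlgHom
  let φ : R →ₐ[k] PowerSeries k := π.comp (IsScalarTower.toAlgHom k R _)
  refine ⟨φ, fun m ↦ ?_⟩
  set y := e.symm (MvPowerSeries.X ⟨0, hr⟩) with hy
  have hπy : π y = PowerSeries.X := by
    change MvPowerSeries.substAlgHom (R := k) ha (e (e.symm _)) = _
    rw [AlgEquiv.apply_symm_apply, MvPowerSeries.substAlgHom_X, if_pos rfl]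
  obtain ⟨p, hp⟩ := Submodule.Quotient.mk_surjective _ (y.1 m)
  -- As `P` is finitely generated, agreeing modulo level `m` means differing by an element of `P ^
  -- m` times the completion. Locality of `φ` sends `P ^ m` into `(X ^ m)`.
  have hker : algebraMap R (AdicCompletion (IsLocalRing.maximalIdeal R) R) p - y ∈
      (IsLocalRing.maximalIdeal R) ^ m •
        (⊤ : Submodule R (AdicCompletion (IsLocalRing.maximalIdeal R) R)) := by
    rw [AdicCompletion.algebraMap_apply, AdicCompletion.pow_smul_top_eq_ker_eval
      (IsLocalRing.maximalIdeal R).fg_of_isNoetherianRing]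
    simpa [AdicCompletion.eval, sub_eq_zero] using hp
  refine ⟨p, ?_⟩
  have h1 : φ p - PowerSeries.X =
      π (algebraMap R (AdicCompletion (IsLocalRing.maximalIdeal R) R) p - y) := by
    rw [map_sub, hπy]; rfl
  rw [h1]
  refine Submodule.smul_induction_on hker (fun q hq z _ ↦ ?_) fun a b ha hb ↦ ?_
  · rw [Algebra.smul_def, map_mul]
    refine Dvd.dvd.mul_right ?_ _
    change _ ∣ φ q
    rw [← Ideal.mem_span_singleton, ← Ideal.span_singleton_pow]
    refine (Ideal.pow_right_mono (Ideal.map_le_iff_le_comap.mpr fun x hx ↦ ?_) m)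
      (Ideal.map_pow φ (IsLocalRing.maximalIdeal R) m ▸ Ideal.mem_map_of_mem φ hq)
    exact Ideal.mem_span_singleton.mpr (X_dvd_of_mem_maximalIdeal φ hx)
  · rw [map_add]; exact dvd_add ha hb

/-- Evaluation of power series at a nilpotent element. -/
theorem exists_algHom_X_eq {k B : Type*} [Field k] [CommRing B] [Algebra k B] {b : B}
    (hb : IsNilpotent b) : ∃ ψ : PowerSeries k →ₐ[k] B, ψ PowerSeries.X = b := by
  -- Substitution takes values in power series over `B`, so substitute the constant series `b` and
  -- read off the constant coefficient.
  have ha : PowerSeries.HasSubst (MvPowerSeries.C b : MvPowerSeries PUnit.{1} B) := by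
    rw [PowerSeries.hasSubst_iff]
    exact MvPowerSeries.hasSubst_of_constantCoeff_nilpotent fun _ ↦ by simpa using hb
  refine ⟨⟨(MvPowerSeries.constantCoeff (R := B)).comp (PowerSeries.substAlgHom (R := k) ha).toRingHom,
    ?_⟩,
    ?_⟩
  · intro c
    change MvPowerSeries.constantCoeff (PowerSeries.substAlgHom (R := k) ha _) = _
    rw [AlgHom.commutes, MvPowerSeries.algebraMap_apply, MvPowerSeries.constantCoeff_C]
  · change MvPowerSeries.constantCoeff (PowerSeries.substAlgHom (R := k) ha _) = _
    rw [PowerSeries.coe_substAlgHom, PowerSeries.subst_X ha, MvPowerSeries.constantCoeff_C]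

/-! ### Families with unbounded nilpotency -/

/-- The coordinate ring of the family `x ^ (n - 1) * (x - t) = 0` over the truncation
`t ^ (M + 1) = 0` of the line. -/
theorem exists_family (k : Type u) [Field k] {n : ℕ} (hn : 0 < n) (M : ℕ) :
    ∃ (A B : Type u) (_ : CommRing A) (_ : CommRing B) (_ : Algebra k A) (_ : Algebra k B)
      (_ : Algebra A B) (_ : IsScalarTower k A B) (x : B), IsNoetherianRing A ∧ Module.Free A B ∧
      Module.rank A B = n ∧ Algebra.adjoin A {x} = ⊤ ∧ IsNilpotent x ∧
      ∀ N ≤ M, x ^ N ≠ 0 := by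
  let f : Polynomial k := Polynomial.X ^ (M + 1)
  let A := AdjoinRoot f
  let t : A := AdjoinRoot.root f
  have htM : t ^ (M + 1) = 0 := by
    have := AdjoinRoot.eval₂_root f
    simpa [f] using this
  have htN : ∀ N ≤ M, t ^ N ≠ 0 := by
    intro N hN h
    have h1 : AdjoinRoot.mk f (Polynomial.X ^ N) = 0 := by simpa using h
    rw [AdjoinRoot.mk_eq_zero, pow_dvd_pow_iff Polynomial.X_ne_zero Polynomial.not_isUnit_X] at h1
    omega
  have : Nontrivial A := ⟨1, 0, by simpa using htN 0 M.zero_le⟩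
  let g : Polynomial A := Polynomial.X ^ n - Polynomial.C t * Polynomial.X ^ (n - 1)
  have hdeg : (Polynomial.C t * Polynomial.X ^ (n - 1)).degree < (n : WithBot ℕ) :=
    (Polynomial.degree_C_mul_X_pow_le _ _).trans_lt (by exact_mod_cast Nat.sub_lt hn one_pos)
  have hXn : (Polynomial.X ^ n : Polynomial A).degree = n := Polynomial.degree_X_pow n
  have hg : g.Monic :=
    (Polynomial.monic_X_pow n).sub_of_left (hdeg.trans_eq hXn.symm)
  have hgd : g.degree = n := by
    rw [Polynomial.degree_sub_eq_left_of_degree_lt (hdeg.trans_eq hXn.symm), hXn]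
  have hgn : g.natDegree = n := Polynomial.natDegree_eq_of_degree_eq_some hgd
  let B := AdjoinRoot g
  let x : B := AdjoinRoot.root g
  have hx : x ^ n = algebraMap A B t * x ^ (n - 1) := by
    have := AdjoinRoot.eval₂_root g
    simp only [g, Polynomial.eval₂_sub, Polynomial.eval₂_mul, Polynomial.eval₂_C,
      Polynomial.eval₂_pow, Polynomial.eval₂_X, sub_eq_zero] at this
    exact this
  -- On multiples of `x ^ (n - 1)`, multiplication by `x` is multiplication by `t`. So `x ^ (n - 1 +
  -- j)` is zero for `j = M + 1`, and nonzero for `j ≤ M` because `t ^ j * X ^ (n - 1)` has degree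
  -- less than that of `g`.
  have hxj : ∀ j, x ^ (n - 1 + j) = algebraMap A B (t ^ j) * x ^ (n - 1) := by
    intro j
    induction j with
    | zero => simp
    | succ j ih =>
      rw [← add_assoc, pow_succ, ih, mul_assoc, ← pow_succ, Nat.sub_add_cancel hn, hx, pow_succ,
        map_mul, mul_assoc]
  refine ⟨A, B, inferInstance, inferInstance, inferInstance, inferInstance, inferInstance,
    inferInstance, x, inferInstance, hg.free_adjoinRoot, ?_, AdjoinRoot.adjoinRoot_eq_top,
    ⟨n - 1 + (M + 1), ?_⟩, ?_⟩
  · rw [rank_eq_card_basis (AdjoinRoot.powerBasis' hg).basis]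
    simp [hgn]
  · rw [hxj, htM, map_zero, zero_mul]
  · intro N hN h
    have h0 : x ^ (n - 1 + N) = 0 := by rw [pow_add, h, mul_zero]
    rw [hxj] at h0
    have h1 : AdjoinRoot.mk g (Polynomial.C (t ^ N) * Polynomial.X ^ (n - 1)) = 0 := by
      rw [map_mul, AdjoinRoot.mk_C, map_pow (AdjoinRoot.mk g), AdjoinRoot.mk_X]
      exact h0
    rw [AdjoinRoot.mk_eq_zero] at h1
    refine hg.not_dvd_of_degree_lt ?_ ?_ h1
    · intro h2
      have h3 := congrArg (Polynomial.coeff · (n - 1)) h2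
      simp only [Polynomial.coeff_C_mul_X_pow, if_true, Polynomial.coeff_zero] at h3
      exact htN N hN h3
    · rw [hgd]
      exact (Polynomial.degree_C_mul_X_pow_le _ _).trans_lt
        (by exact_mod_cast Nat.sub_lt hn one_pos)

/-! ### Points of the functor with affine base -/

/-- The fibres of a free algebra have its rank. -/
theorem fiberRank_specMap {A B : Type u} [CommRing A] [CommRing B] [Algebra A B] [Module.Free A B]
    (y : Spec (CommRingCat.of A)) :
    fiberRank (Spec.map (CommRingCat.ofHom (algebraMap A B))) y = Module.rank A B := by
  set f := Spec.map (CommRingCat.ofHom (algebraMap A B)) with hf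
  set K := (Spec (CommRingCat.of A)).residueField y
  have hp : IsPullback (f.fiberι y) (f.fiberToSpecResidueField y) f
      ((Spec (CommRingCat.of A)).fromSpecResidueField y) := IsPullback.of_hasPullback _ _
  let α : CommRingCat.of A ⟶ K := (Scheme.ΓSpecIso (CommRingCat.of A)).inv ≫
    ((Spec (CommRingCat.of A)).fromSpecResidueField y).appTop ≫ (Scheme.ΓSpecIso K).hom
  -- Global sections turn the cartesian square of the fibre into a pushout of rings, so the fibre
  -- has coordinate ring `K ⊗ B` over `A`.
  have e : IsPushout (CommRingCat.ofHom (algebraMap A B)) α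
      ((Scheme.ΓSpecIso (CommRingCat.of B)).inv ≫ (f.fiberι y).appTop)
      ((Scheme.ΓSpecIso K).inv ≫ (f.fiberToSpecResidueField y).appTop) := by
    refine (isPushout_appTop_of_isPullback hp).of_iso (Scheme.ΓSpecIso _) (Scheme.ΓSpecIso _)
      (Scheme.ΓSpecIso _) (Iso.refl _) ?_ ?_ ?_ ?_
    · exact Scheme.ΓSpecIso_naturality _
    · simp [α]; rfl
    · simp
    · exact (Category.comp_id _).trans (Iso.hom_inv_id_assoc _ _).symm
  let : Algebra A Γ(f.fiber y, ⊤) :=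
    RingHom.toAlgebra (CommRingCat.ofHom (algebraMap A B) ≫
      (Scheme.ΓSpecIso (CommRingCat.of B)).inv ≫ (f.fiberι y).appTop).hom
  let : Algebra B Γ(f.fiber y, ⊤) :=
    RingHom.toAlgebra ((Scheme.ΓSpecIso (CommRingCat.of B)).inv ≫ (f.fiberι y).appTop).hom
  let : Algebra K Γ(f.fiber y, ⊤) :=
    RingHom.toAlgebra ((Scheme.ΓSpecIso K).inv ≫ (f.fiberToSpecResidueField y).appTop).hom
  let : Algebra A K := α.hom.toAlgebra
  have : IsScalarTower A B Γ(f.fiber y, ⊤) := .of_algebraMap_eq' rfl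
  have : IsScalarTower A K Γ(f.fiber y, ⊤) :=
    .of_algebraMap_eq' (congrArg CommRingCat.Hom.hom e.w)
  have hA : Algebra.IsPushout A K B Γ(f.fiber y, ⊤) :=
    (CommRingCat.isPushout_iff_isPushout.mp e).symm
  refine (Algebra.IsPushout.equiv A K B Γ(f.fiber y, ⊤)).toLinearEquiv.rank_eq.symm.trans ?_
  have : Nontrivial A := y.nontrivial
  rw [Module.rank_baseChange, Cardinal.lift_id]

variable {k : Type u} [Field k] {R : Type u} [CommRing R] [Algebra k R]

theorem mem_support_closedPointIdeal_iff [IsLocalRing R] {T : Over (Spec (CommRingCat.of k))}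
    {x : prodSpec k R T} : x ∈ (closedPointIdeal k R T).support ↔
      ∀ p ∈ IsLocalRing.maximalIdeal R,
        p ∈ (pullback.snd T.hom (specHom k R) x : PrimeSpectrum R).asIdeal := by
  have h : ((Spec.map (CommRingCat.ofHom (IsLocalRing.residue R))).ker.support :
      Set (Spec (CommRingCat.of R))) =
        PrimeSpectrum.zeroLocus (IsLocalRing.maximalIdeal R : Set R) := by
    refine (Scheme.Hom.support_ker _).trans ?_
    rw [← IsLocalRing.ker_residue]
    refine Eq.trans ?_ (PrimeSpectrum.closure_range_comap (IsLocalRing.residue R))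
    rfl
  rw [closedPointIdeal, Scheme.IdealSheafData.support_comap]
  exact Set.ext_iff.mp h (pullback.snd T.hom (specHom k R) x)

/-- Elements of the maximal ideal are nilpotent on the points of the local Hilbert functor. -/
theorem IsPoint.isNilpotent_appTop [IsLocalRing R] {n : ℕ}
    {T : Over (Spec (CommRingCat.of k))} [CompactSpace T.left]
    {I : (prodSpec k R T).IdealSheafData} (h : IsPoint k R n T I) {p : R}
    (hp : p ∈ IsLocalRing.maximalIdeal R) :
    IsNilpotent ((I.subschemeι ≫ pullback.snd T.hom (specHom k R)).appTop
      ((Scheme.ΓSpecIso (CommRingCat.of R)).inv p)) := by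
  have : CompactSpace I.subscheme :=
    QuasiCompact.compactSpace_of_compactSpace (proj k R T I)
  -- On a quasi-compact scheme a function is nilpotent once it vanishes at every point; here every
  -- point lies over the closed point of `Spec R`.
  rw [Scheme.isNilpotent_iff_basicOpen_eq_bot, ← Scheme.Hom.preimage_basicOpen_top,
    basicOpen_eq_of_affine', eq_bot_iff]
  intro z hz
  have hz' : I.subschemeι z ∈ I.support :=
    I.range_subschemeι.le ⟨z, rfl⟩
  have h1 := mem_support_closedPointIdeal_iff.mp ((radical_le_iff _ _).mp h.supp hz') p hp
  refine hz ?_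
  simpa using h1

/-- The closed subscheme of `Spec A ×_k Spec R` given by an `A`-algebra `B` and a homomorphism
`R → B`. -/
noncomputable def specLift {A B : Type u} [CommRing A] [CommRing B] [Algebra k A] [Algebra k B]
    [Algebra A B] [IsScalarTower k A B] (φ : R →ₐ[k] B) :
    Spec (CommRingCat.of B) ⟶ prodSpec k R (Over.mk (specHom k A)) :=
  pullback.lift (Spec.map (CommRingCat.ofHom (algebraMap A B)))
    (Spec.map (CommRingCat.ofHom (φ : R →+* B))) (by
      simp only [Over.mk_hom, specHom, ← Spec.map_comp, ← CommRingCat.ofHom_comp]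
      congr 2
      exact (IsScalarTower.algebraMap_eq k A B).symm.trans φ.comp_algebraMap.symm)

section

variable {A B : Type u} [CommRing A] [CommRing B] [Algebra k A] [Algebra k B]
    [Algebra A B] [IsScalarTower k A B] (φ : R →ₐ[k] B)

/-- The image of `A ⊗ R → B` is the `A`-subalgebra generated by `φ(R)`, so the hypothesis is
surjectivity of this map. -/
theorem isClosedImmersion_specLift (hφ : Algebra.adjoin A (Set.range φ) = ⊤) :
    IsClosedImmersion (specLift (A := A) φ) := by
  let ψ : A ⊗[k] R →ₐ[A] B := Algebra.TensorProduct.lift (Algebra.ofId A B) φ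
    fun _ _ ↦ .all _ _
  have hψ : Function.Surjective ψ := by
    rw [← AlgHom.range_eq_top, eq_top_iff, ← hφ, Algebra.adjoin_le_iff]
    rintro _ ⟨x, rfl⟩
    exact ⟨1 ⊗ₜ x, by simp [ψ]⟩
  have h1 : IsClosedImmersion (Spec.map (CommRingCat.ofHom ψ.toRingHom)) :=
    IsClosedImmersion.spec_of_surjective _ hψ
  let ι : Spec (CommRingCat.of (A ⊗[k] R)) ⟶ prodSpec k R (Over.mk (specHom k A)) :=
    (pullbackSpecIso k A R).inv
  have hι : IsIso ι := inferInstanceAs (IsIso (pullbackSpecIso k A R).inv)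
  have h2 : specLift (A := A) φ = Spec.map (CommRingCat.ofHom ψ.toRingHom) ≫ ι := by
    apply pullback.hom_ext
    · refine (pullback.lift_fst _ _ _).trans ?_
      refine Eq.trans ?_ (Category.assoc _ _ _).symm
      erw [pullbackSpecIso_inv_fst]
      rw [← Spec.map_comp, ← CommRingCat.ofHom_comp]
      congr 2
      ext a
      simp [ψ]
    · refine (pullback.lift_snd _ _ _).trans ?_
      refine Eq.trans ?_ (Category.assoc _ _ _).symm
      erw [pullbackSpecIso_inv_snd]
      rw [← Spec.map_comp, ← CommRingCat.ofHom_comp]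
      congr 2
      ext a
      simp [ψ]
  rw [h2]
  infer_instance

/-- A closed immersion identifies `Spec B` with its scheme-theoretic image, so flatness and fibre
rank are those of the free algebra `B`. For the support, a prime of `B` contains all nilpotents,
hence its preimage in `R` contains `P`. -/
theorem isPoint_specLift [IsLocalRing R] [Module.Free A B] {n : ℕ} (hn : Module.rank A B = n)
    (hφ : Algebra.adjoin A (Set.range φ) = ⊤)
    (hP : ∀ p ∈ IsLocalRing.maximalIdeal R, IsNilpotent (φ p)) :
    IsPoint k R n (Over.mk (specHom k A)) (specLift (A := A) φ).ker := by
  have := isClosedImmersion_specLift (A := A) φ hφ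
  have hfac : (specLift (A := A) φ).toImage ≫
      proj k R (Over.mk (specHom k A)) (specLift (A := A) φ).ker =
      Spec.map (CommRingCat.ofHom (algebraMap A B)) := by
    refine (Category.assoc _ _ _).symm.trans ?_
    erw [Scheme.Hom.toImage_imageι]
    exact pullback.lift_fst _ _ _
  refine ⟨?_, fun y ↦ ?_, ?_⟩
  · have hflat : Flat (Spec.map (CommRingCat.ofHom (algebraMap A B))) := by
      rw [Flat.SpecMap_iff]
      exact RingHom.flat_algebraMap_iff.mpr inferInstance
    rw [(IsIso.eq_inv_comp _).mpr hfac]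
    infer_instance
  · have hpb : IsPullback (specLift (A := A) φ).toImage
        (Spec.map (CommRingCat.ofHom (algebraMap A B)))
        (proj k R (Over.mk (specHom k A)) (specLift (A := A) φ).ker) (𝟙 _) :=
      IsPullback.of_horiz_isIso ⟨by rw [hfac, Category.comp_id]⟩
    rw [← hn, ← fiberRank_specMap (A := A) (B := B) y]
    exact (fiberRank_of_isPullback hpb y).symm
  · rw [radical_le_iff]
    change (_ : Set _) ⊆ _
    rw [Scheme.Hom.support_ker]
    refine closure_minimal ?_ (closedPointIdeal k R (Over.mk (specHom k A))).support.isClosed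
    rintro _ ⟨z, rfl⟩
    refine mem_support_closedPointIdeal_iff.mpr fun p hp ↦ ?_
    have h1 : pullback.snd (specHom k A) (specHom k R) (specLift (A := A) φ z) =
        Spec.map (CommRingCat.ofHom (φ : R →+* B)) z := by
      rw [← Scheme.Hom.comp_apply]
      have h2 : specLift (A := A) φ ≫ pullback.snd (specHom k A) (specHom k R) =
        Spec.map (CommRingCat.ofHom (φ : R →+* B)) := pullback.lift_snd _ _ _
      rw [← h2]
    erw [h1]
    exact (hP p hp).elim fun m hm ↦ z.2.mem_of_pow_mem m (hm ▸ z.asIdeal.zero_mem)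

end

/-! ### Non-representability -/

/-- A representing object bounds the nilpotency of the elements of the maximal ideal on all
points with affine base. -/
theorem exists_pow_eq_zero_of_isRepresentable [IsLocalRing R] {n : ℕ}
    (h : (hilb k R n).IsRepresentable) {p : R} (hp : p ∈ IsLocalRing.maximalIdeal R) :
    ∃ N : ℕ, ∀ (A B : Type u) [CommRing A] [CommRing B] [Algebra k A] [Algebra k B]
      [Algebra A B] [IsScalarTower k A B] (φ : R →ₐ[k] B), IsNoetherianRing A → Module.Free A B →
      Module.rank A B = n → Algebra.adjoin A (Set.range φ) = ⊤ →
      (∀ q ∈ IsLocalRing.maximalIdeal R, IsNilpotent (φ q)) → φ p ^ N = 0 := by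
  obtain ⟨H, ⟨e⟩⟩ := h.has_representation
  let Z := e.homEquiv (𝟙 H)
  have hH : AlgebraicGeometry.IsNoetherian H.obj.left := H.property
  -- The exponent comes from the universal family alone, before any `A`, `B` or `φ` is chosen.
  obtain ⟨N, hN⟩ := Z.2.isNilpotent_appTop hp
  refine ⟨N, fun A B _ _ _ _ _ _ φ hA hB hn hφ hP ↦ ?_⟩
  have hpt := isPoint_specLift (A := A) φ hn hφ hP
  let T : NoethSch k := ⟨Over.mk (specHom k A),
    inferInstanceAs (AlgebraicGeometry.IsNoetherian (Spec (CommRingCat.of A)))⟩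
  let f : T ⟶ H := e.homEquiv.symm ⟨_, hpt⟩
  have hf : Z.1.comap (prodSpecMap k R f.hom) = (specLift (A := A) φ).ker :=
    congrArg Subtype.val ((e.homEquiv_eq f).symm.trans (e.homEquiv.apply_symm_apply _))
  -- The family is a pullback of `Z`, so it maps to `Z` compatibly with the projections to `Spec R`;
  -- hence `φ p` is the pullback of the function `p` on `Z`.
  obtain ⟨g, hg⟩ : ∃ g : Spec (CommRingCat.of B) ⟶ Z.1.subscheme,
      g ≫ Z.1.subschemeι ≫ pullback.snd _ _ = Spec.map (CommRingCat.ofHom (φ : R →+* B)) := by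
    obtain ⟨g, hg⟩ : ∃ g : Spec (CommRingCat.of B) ⟶
        (Z.1.comap (prodSpecMap k R f.hom)).subscheme,
        g ≫ (Z.1.comap (prodSpecMap k R f.hom)).subschemeι = specLift (A := A) φ := by
      rw [hf]
      exact ⟨(specLift (A := A) φ).toImage, (specLift (A := A) φ).toImage_imageι⟩
    refine ⟨g ≫ (Z.1.comapIso (prodSpecMap k R f.hom)).hom ≫ pullback.snd _ _, ?_⟩
    rw [Category.assoc, Category.assoc, ← pullback.condition_assoc,
      Scheme.IdealSheafData.comapIso_hom_fst_assoc, prodSpecMap_snd, reassoc_of% hg]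
    exact pullback.lift_snd _ _ _
  have h1 : g.appTop ((Z.1.subschemeι ≫ pullback.snd _ _).appTop
      ((Scheme.ΓSpecIso (CommRingCat.of R)).inv p)) =
      (Scheme.ΓSpecIso (CommRingCat.of B)).inv (φ p) := by
    have h2 := Scheme.ΓSpecIso_inv_naturality (CommRingCat.ofHom (φ : R →+* B))
    rw [← hg, Scheme.Hom.comp_appTop] at h2
    exact congr($h2 p).symm
  have h2 := congrArg g.appTop hN
  rw [map_pow, h1, map_zero, ← map_pow] at h2
  have h3 := congrArg (Scheme.ΓSpecIso (CommRingCat.of B)).hom h2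
  simpa using h3

end LocalHilb

theorem theorem4p8 (k : Type u) [Field k] (R : Type u) [CommRing R] [Algebra k R]
    [IsLocalRing R] [IsNoetherianRing R] (r : ℕ) (hr : 0 < r)
    (hR : Nonempty (AdicCompletion (IsLocalRing.maximalIdeal R) R ≃ₐ[k]
      MvPowerSeries (Fin r) k))
    (n : ℕ) (hn : 0 < n) :
    ¬ (LocalHilb.hilb k R n).IsRepresentable := by
  intro h
  obtain ⟨φ, hφ⟩ := LocalHilb.exists_algHom_powerSeries hr hR.some
  -- Precision `2` gives `φ p = X + X ^ 2 * v`, of order exactly one: `p` is a nonunit, and its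
  -- image in `B` will be `x` times a unit.
  obtain ⟨p, v, hv⟩ := hφ 2
  have hp : p ∈ IsLocalRing.maximalIdeal R := by
    intro hu
    have h1 := (hu.map φ).map (PowerSeries.constantCoeff (R := k))
    rw [sub_eq_iff_eq_add.mp hv] at h1
    simp at h1
  obtain ⟨N, hN⟩ := LocalHilb.exists_pow_eq_zero_of_isRepresentable h hp
  obtain ⟨A, B, _, _, _, _, _, _, x, hA, hB, hrank, hadj, hx, hxN⟩ :=
    LocalHilb.exists_family k hn N
  obtain ⟨ψ, hψ⟩ := LocalHilb.exists_algHom_X_eq (k := k) hx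
  -- Once `x ^ m = 0`, approximating `X` modulo `X ^ m` hits `x` exactly.
  have hdense : x ∈ Set.range (ψ.comp φ) := by
    obtain ⟨m, hm⟩ := hx
    obtain ⟨q, w, hw⟩ := hφ m
    refine ⟨q, ?_⟩
    rw [AlgHom.comp_apply, sub_eq_iff_eq_add.mp hw, map_add, map_mul, map_pow, hψ, hm, zero_mul,
      zero_add]
  have hpN := hN A B (ψ.comp φ) hA hB hrank
    (top_unique (hadj ▸ Algebra.adjoin_mono (Set.singleton_subset_iff.mpr hdense)))
    fun q hq ↦ by
      obtain ⟨w, hw⟩ := LocalHilb.X_dvd_of_mem_maximalIdeal φ hq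
      rw [AlgHom.comp_apply, hw, map_mul, hψ]
      exact (Commute.all _ _).isNilpotent_mul_right hx
  have hunit : IsUnit (1 + x * ψ v) :=
    ((Commute.all _ _).isNilpotent_mul_right hx).isUnit_one_add
  have hpx : (ψ.comp φ) p = x * (1 + x * ψ v) := by
    rw [AlgHom.comp_apply, sub_eq_iff_eq_add.mp hv, map_add, map_mul, map_pow, hψ]
    ring
  rw [hpx, mul_pow] at hpN
  exact hxN N le_rfl ((hunit.pow N).mul_left_eq_zero.mp hpN)
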